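/- Let $U$ be an ultrafilter on a set $I$, and for a set $S$ let ${}^*S=S^I/\!\sim$ be its ultrapower with respect to $U$. For $d\ge 0$ and an open set $\Omega\subseteq\mathbb R^d$ let $\mathcal E(\Omega)=C^\infty(\Omega,\mathbb C)$. An element $\langle f_i\rangle\in{}^*\mathcal E(\Omega)$ is evaluated at points of ${}^*\Omega=\{\langle x_i\rangle\in{}^*\mathbb R^d: x_i\in\Omega \text{ for } U\text{-almost all } i\}$ by $\langle f_i\rangle(\langle x_i\rangle)=\langle f_i(x_i)\rangle$, and $\partial^\alpha\langle f_i\rangle=\langle\partial^\alpha f_i\rangle$ for $\alpha\in\mathbb N_0^d$. For $\mathcal O\subseteq\Omega$ open, $\langle f_i\rangle|{}^*\mathcal O=\langle f_i|\mathcal O\rangle\in{}^*\mathcal E(\mathcal O)$. Let $\mu(\Omega)=\{r+dx: r\in\Omega,\ dx\in{}^*\mathbb R^d,\ \|dx\|\approx 0\}$ be the monad of $\Omega$. Let $\mathcal M$ be a convex subring of ${}^*\mathbb C$ (a subring with $1$ such that $z\in{}^*\mathbb C$, $\zeta\in\mathcal M$, $|z|\le|\zeta|$ imply $z\in\mathcal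 M$), and let $\mathcal M_0=\{z\in\mathcal M: z=0\text{ or }1/z\notin\mathcal M\}$. Put $$\mathcal M(\Omega)=\{f\in{}^*\mathcal E(\Omega):\ \partial^\alpha f(x)\in\mathcal M\ \text{ for all }\alpha\in\mathbb N_0^d,\ x\in\mu(\Omega)\},$$ $$\mathcal M_0(\Omega)=\{f\in{}^*\mathcal E(\Omega):\ \partial^\alpha f(x)\in\mathcal M_0\ \text{ for all }\alpha\in\mathbb N_0^d,\ x\in\mu(\Omega)\},$$ and let $\widehat{\mathcal M}(\Omega)=\mathcal M(\Omega)/\mathcal M_0(\Omega)$ be the ring of $\mathcal M$-asymptotic functions on $\Omega$, where $\widehat f$ is the class of $f\in\mathcal M(\Omega)$. Put $\partial^\alpha\widehat f=\widehat{\partial^\alpha f}$, and for $\mathcal O\subseteq\Omega$ open define the restriction $\widehat f\restriction\mathcal O=\widehat{f|{}^*\mathcal O}\in\widehat{\mathcal M}(\mathcal O)$. **Theorem.** The family $\{\widehat{\mathcal M}(\Omega)\}$, indexed by the open sets $\Omega\subseteq\mathbb R^d$, is a sheaf of differential rings on $\mathbb R^d$ under $\restriction$. That is, each $\widehat{\mathcal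 M}(\Omega)$ is a commutative differential ring (the maps $\partial^\alpha$ are additive, $\partial^0=\mathrm{id}$, $\partial^{\alpha+\beta}=\partial^\alpha\partial^\beta$, and the first-order ones satisfy the Leibniz rule), and: (i) $\widehat f\restriction\Omega=\widehat f$ for all $\widehat f\in\widehat{\mathcal M}(\Omega)$. (ii) If $\Omega_1\subseteq\Omega_2\subseteq\Omega$ are open, then $(\widehat f\restriction\Omega_2)\restriction\Omega_1=\widehat f\restriction\Omega_1$ for all $\widehat f\in\widehat{\mathcal M}(\Omega)$. Let $\Omega=\bigcup_{\lambda\in\Lambda}\Omega_\lambda$ be an open covering, with an arbitrary index set $\Lambda$. Then: (iii) If $\widehat f\in\widehat{\mathcal M}(\Omega)$ and $\widehat f\restriction\Omega_\lambda=0$ for all $\lambda\in\Lambda$, then $\widehat f=0$. (iv) If $\widehat f_\lambda\in\widehat{\mathcal M}(\Omega_\lambda)$ $(\lambda\in\Lambda)$ satisfy $\widehat f_{\lambda_1}\restriction(\Omega_{\lambda_1}\cap\Omega_{\lambda_2})=\widehat f_{\lambda_2}\restriction(\Omega_{\lambda_1}\cap\Omega_{\lambda_2})$ whenever $\Omega_{\lambda_1}\cap\Omega_{\lambda_2}\ne\varnothing$,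 then there is $\widehat f\in\widehat{\mathcal M}(\Omega)$ with $\widehat f\restriction\Omega_\lambda=\widehat f_\lambda$ for all $\lambda\in\Lambda$. (v) For open $\mathcal O\subseteq\Omega$, $\widehat f,\widehat g\in\widehat{\mathcal M}(\Omega)$ and $\alpha\in\mathbb N_0^d$: $(\partial^\alpha\widehat f)\restriction\mathcal O=\partial^\alpha(\widehat f\restriction\mathcal O)$, $(\widehat f+\widehat g)\restriction\mathcal O=\widehat f\restriction\mathcal O+\widehat g\restriction\mathcal O$ and $(\widehat f\,\widehat g)\restriction\mathcal O=(\widehat f\restriction\mathcal O)(\widehat g\restriction\mathcal O)$. Consequently, for every $\widehat f\in\widehat{\mathcal M}(\Omega)$ there is a largest open set $\mathcal O\subseteq\Omega$ with $\widehat f\restriction\mathcal O=0$, and the support $\operatorname{supp}\widehat f=\Omega\setminus\mathcal O$ is closed in $\Omega$. -/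

import Mathlib

open Filter Topology TopologicalSpace
open scoped ContDiff

noncomputable section

namespace AsymptoticFunctions

universe u

/-! ### Smooth functions on an open set -/

/-- The Euclidean space `ℝ^d`. -/
abbrev Eucl (d : ℕ) : Type := EuclideanSpace ℝ (Fin d)

variable {d : ℕ}

open Classical in
/-- Extension by zero of a function on `Ω` to all of `ℝ^d`. Only its values at points of `Ω` (and
its germs there) are ever used. -/
def extend (Ω : Opens (Eucl d)) (f : Ω → ℂ) : Eucl d → ℂ :=
  fun x => if h : x ∈ Ω then f ⟨x, h⟩ else 0

theorem extend_of_mem {Ω : Opens (Eucl d)} (f : Ω → ℂ) {x : Eucl d} (h : x ∈ Ω) :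
    extend Ω f x = f ⟨x, h⟩ := dif_pos h

theorem extend_add (Ω : Opens (Eucl d)) (f g : Ω → ℂ) :
    extend Ω (f + g) = extend Ω f + extend Ω g := by
  funext x; by_cases h : x ∈ Ω <;> simp [extend, h]

theorem extend_mul (Ω : Opens (Eucl d)) (f g : Ω → ℂ) :
    extend Ω (f * g) = extend Ω f * extend Ω g := by
  funext x; by_cases h : x ∈ Ω <;> simp [extend, h]

theorem extend_smul (Ω : Opens (Eucl d)) (c : ℂ) (f : Ω → ℂ) :
    extend Ω (c • f) = c • extend Ω f := by
  funext x; by_cases h : x ∈ Ω <;> simp [extend, h]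

/-- `𝓔(Ω) = C^∞(Ω)`: the algebra of complex valued smooth functions on `Ω`, with the pointwise
operations. -/
def Smooth (Ω : Opens (Eucl d)) : Subalgebra ℂ (Ω → ℂ) where
  carrier := {f | ContDiffOn ℝ ∞ (extend Ω f) (Ω : Set (Eucl d))}
  mul_mem' {f g} hf hg := by
    have : ContDiffOn ℝ ∞ (fun x => extend Ω f x * extend Ω g x) (Ω : Set (Eucl d)) := hf.mul hg
    simp only [Set.mem_ofPred_eq, extend_mul]; exact this
  add_mem' {f g} hf hg := by
    have : ContDiffOn ℝ ∞ (fun x => extend Ω f x + extend Ω g x) (Ω : Set (Eucl d)) := hf.add hg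
    simp only [Set.mem_ofPred_eq, extend_add]; exact this
  algebraMap_mem' c := by
    have : ContDiffOn ℝ ∞ (fun _ : Eucl d => c) (Ω : Set (Eucl d)) := contDiffOn_const
    exact this.congr fun x hx => by rw [extend_of_mem _ hx]; rfl

theorem smooth_contDiffAt {Ω : Opens (Eucl d)} (f : Smooth Ω) {x : Eucl d} (hx : x ∈ Ω) :
    ContDiffAt ℝ ∞ (extend Ω f) x :=
  ContDiffOn.contDiffAt f.2 (Ω.2.mem_nhds hx)

theorem smooth_differentiableAt {Ω : Opens (Eucl d)} (f : Smooth Ω) {x : Eucl d} (hx : x ∈ Ω) :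
    DifferentiableAt ℝ (extend Ω f) x :=
  (smooth_contDiffAt f hx).differentiableAt (by simp)

/-- The partial derivative `∂/∂xᵢ` on `𝓔(Ω)`. -/
def pderiv {Ω : Opens (Eucl d)} (i : Fin d) : Module.End ℂ (Smooth Ω) where
  toFun f := ⟨fun x => fderiv ℝ (extend Ω f) x (EuclideanSpace.single i 1), by
    have h1 : ContDiffOn ℝ ∞ (fderiv ℝ (extend Ω f)) (Ω : Set (Eucl d)) :=
      ContDiffOn.fderiv_of_isOpen f.2 Ω.2 (by simp)
    have h2 : ContDiffOn ℝ ∞ (fun x => fderiv ℝ (extend Ω f) x (EuclideanSpace.single i 1))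
        (Ω : Set (Eucl d)) := h1.clm_apply contDiffOn_const
    exact h2.congr fun x hx => extend_of_mem _ hx⟩
  map_add' f g := by
    ext x
    change fderiv ℝ (extend Ω ((f : Ω → ℂ) + (g : Ω → ℂ))) x _ = _
    rw [extend_add, fderiv_add (smooth_differentiableAt f x.2) (smooth_differentiableAt g x.2)]
    rfl
  map_smul' c f := by
    ext x
    change fderiv ℝ (extend Ω (c • (f : Ω → ℂ))) x _ = _
    rw [extend_smul, fderiv_const_smul (smooth_differentiableAt f x.2)]
    rfl

theorem pderiv_apply {Ω : Opens (Eucl d)} (i : Fin d) (f : Smooth Ω) (x : Ω) :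
    (pderiv i f : Ω → ℂ) x = fderiv ℝ (extend Ω f) x (EuclideanSpace.single i 1) := rfl

theorem pderiv_mul {Ω : Opens (Eucl d)} (i : Fin d) (f g : Smooth Ω) :
    pderiv i (f * g) = pderiv i f * g + f * pderiv i g := by
  ext x
  change fderiv ℝ (extend Ω ((f : Ω → ℂ) * (g : Ω → ℂ))) x _ =
    fderiv ℝ (extend Ω f) x (EuclideanSpace.single i 1) * (g : Ω → ℂ) x +
      (f : Ω → ℂ) x * fderiv ℝ (extend Ω g) x (EuclideanSpace.single i 1)
  rw [extend_mul, fderiv_mul (smooth_differentiableAt f x.2) (smooth_differentiableAt g x.2)]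
  simp only [add_apply, smul_apply, smul_eq_mul,
    extend_of_mem _ x.2]
  ring

theorem extend_pderiv {Ω : Opens (Eucl d)} (i : Fin d) (f : Smooth Ω) {x : Eucl d} (hx : x ∈ Ω) :
    extend Ω (pderiv i f : Smooth Ω) =ᶠ[𝓝 x]
      fun y => fderiv ℝ (extend Ω f) y (EuclideanSpace.single i 1) := by
  filter_upwards [Ω.2.mem_nhds hx] with y hy
  rw [extend_of_mem _ hy]; rfl

theorem pderiv_pderiv_apply {Ω : Opens (Eucl d)} (i j : Fin d) (f : Smooth Ω) (x : Ω) :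
    (pderiv i (pderiv j f) : Ω → ℂ) x =
      fderiv ℝ (fderiv ℝ (extend Ω f)) x (EuclideanSpace.single i 1)
        (EuclideanSpace.single j 1) := by
  rw [pderiv_apply, (extend_pderiv j f x.2).fderiv_eq]
  have hd : DifferentiableAt ℝ (fderiv ℝ (extend Ω f)) x :=
    ((smooth_contDiffAt f x.2).fderiv_right (m := ∞) (by simp)).differentiableAt (by simp)
  rw [fderiv_clm_apply hd (differentiableAt_const _)]
  simp

theorem pderiv_comm {Ω : Opens (Eucl d)} (i j : Fin d) :
    Commute (pderiv i : Module.End ℂ (Smooth Ω)) (pderiv j) := by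
  refine LinearMap.ext fun f => ?_
  ext x
  change (pderiv i (pderiv j f) : Ω → ℂ) x = (pderiv j (pderiv i f) : Ω → ℂ) x
  rw [pderiv_pderiv_apply, pderiv_pderiv_apply]
  exact ((smooth_contDiffAt f x.2).isSymmSndFDerivAt (by
    rw [minSmoothness_of_isRCLikeNormedField]
    exact WithTop.coe_le_coe.2 le_top)).eq _ _

theorem pderiv_pairwise {Ω : Opens (Eucl d)} (α β : Fin d → ℕ) (s : Set (Fin d)) :
    s.Pairwise fun i j => Commute ((pderiv i : Module.End ℂ (Smooth Ω)) ^ α i) (pderiv j ^ β j) :=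
  fun i _ j _ _ => (pderiv_comm i j).pow_pow (α i) (β j)

/-- The partial derivative `∂^α = ∏ᵢ (∂/∂xᵢ)^αᵢ` on `𝓔(Ω)`, for a multi-index `α ∈ ℕ₀^d`. The
factors commute. -/
def mderiv {Ω : Opens (Eucl d)} (α : Fin d → ℕ) : Module.End ℂ (Smooth Ω) :=
  Finset.univ.noncommProd (fun i => pderiv i ^ α i)
    (pderiv_pairwise α α _)

theorem mderiv_zero {Ω : Opens (Eucl d)} : (mderiv 0 : Module.End ℂ (Smooth Ω)) = 1 := by
  unfold mderiv
  rw [Finset.noncommProd_eq_pow_card _ _ _ 1 (by simp)]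
  simp

theorem mderiv_add {Ω : Opens (Eucl d)} (α β : Fin d → ℕ) :
    (mderiv (α + β) : Module.End ℂ (Smooth Ω)) = mderiv α * mderiv β := by
  unfold mderiv
  rw [← Finset.noncommProd_mul_distrib]
  · exact Finset.noncommProd_congr rfl (fun i _ => by rw [Pi.add_apply, pow_add]; rfl) _
  · exact pderiv_pairwise β α _

theorem mderiv_single {Ω : Opens (Eucl d)} (i : Fin d) :
    (mderiv (Pi.single i 1) : Module.End ℂ (Smooth Ω)) = pderiv i := by
  unfold mderiv
  refine (Finset.mul_noncommProd_erase Finset.univ (Finset.mem_univ i) _ _).symm.trans ?_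
  refine (congrArg₂ (· * ·) (Eq.trans ?_ (pow_one (pderiv i)))
    ((Finset.noncommProd_eq_pow_card _ _ _ 1 ?_).trans (one_pow _))).trans (mul_one _)
  · rw [Pi.single_eq_same]
  · intro j hj
    rw [Pi.single_eq_of_ne (Finset.ne_of_mem_erase hj), pow_zero]

/-- The pointwise restriction `f ↦ f|𝓞` from `𝓔(Ω)` to `𝓔(𝓞)`, for `𝓞 ⊆ Ω`. -/
def Smooth.restrict {O Ω : Opens (Eucl d)} (h : O ≤ Ω) : Smooth Ω →+* Smooth O where
  toFun f := ⟨fun x => (f : Ω → ℂ) ⟨x, h x.2⟩, by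
    have h1 : ContDiffOn ℝ ∞ (extend Ω f) (O : Set (Eucl d)) :=
      ContDiffOn.mono (t := (O : Set (Eucl d))) f.2 h
    exact h1.congr fun x hx => by rw [extend_of_mem _ hx, extend_of_mem _ (h hx)]⟩
  map_one' := rfl
  map_mul' _ _ := rfl
  map_zero' := rfl
  map_add' _ _ := rfl

theorem extend_restrict {O Ω : Opens (Eucl d)} (h : O ≤ Ω) (f : Smooth Ω) {x : Eucl d}
    (hx : x ∈ O) : extend O (Smooth.restrict h f) x = extend Ω f x := by
  rw [extend_of_mem _ hx, extend_of_mem _ (h hx)]; rfl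

theorem pderiv_restrict {O Ω : Opens (Eucl d)} (h : O ≤ Ω) (i : Fin d) (f : Smooth Ω) :
    pderiv i (Smooth.restrict h f) = Smooth.restrict h (pderiv i f) := by
  ext x
  change fderiv ℝ (extend O (Smooth.restrict h f)) x _ = fderiv ℝ (extend Ω f) x _
  have : extend O (Smooth.restrict h f) =ᶠ[𝓝 (x : Eucl d)] extend Ω f := by
    filter_upwards [O.2.mem_nhds x.2] with y hy using extend_restrict h f hy
  rw [this.fderiv_eq]

/-- Induction on multi-indices. -/
theorem multiindex_induction {p : (Fin d → ℕ) → Prop} (h0 : p 0)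
    (h1 : ∀ α i, p α → p (α + Pi.single i 1)) (α : Fin d → ℕ) : p α := by
  obtain ⟨n, hn⟩ : ∃ n, ∑ i, α i = n := ⟨_, rfl⟩
  induction n generalizing α with
  | zero =>
    have : α = 0 := by
      funext i
      exact (Finset.sum_eq_zero_iff.1 hn) i (Finset.mem_univ i)
    exact this ▸ h0
  | succ n ih =>
    obtain ⟨i, hi⟩ : ∃ i, α i ≠ 0 := by
      by_contra! hc
      simp [hc] at hn
    have hα : α = (α - Pi.single i 1) + Pi.single i 1 := by
      funext j
      by_cases hj : j = i
      · subst hj; simp; omega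
      · simp [hj]
    rw [hα]
    apply h1
    apply ih
    have h2 : ∑ j, α j = ∑ j, ((α - Pi.single i 1 : Fin d → ℕ) j + (Pi.single i 1 : Fin d → ℕ) j) :=
      Finset.sum_congr rfl fun j _ => congrFun hα j
    rw [Finset.sum_add_distrib] at h2
    simp only [Finset.sum_pi_single', Finset.mem_univ, if_true] at h2
    omega

theorem mderiv_add_single {Ω : Opens (Eucl d)} (α : Fin d → ℕ) (i : Fin d) (f : Smooth Ω) :
    mderiv (α + Pi.single i 1) f = mderiv α (pderiv i f) := by
  rw [mderiv_add, mderiv_single]; rfl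

theorem mderiv_restrict {O Ω : Opens (Eucl d)} (h : O ≤ Ω) (α : Fin d → ℕ) (f : Smooth Ω) :
    mderiv α (Smooth.restrict h f) = Smooth.restrict h (mderiv α f) := by
  induction α using multiindex_induction generalizing f with
  | h0 => simp [mderiv_zero]
  | h1 α i ih => rw [mderiv_add_single, mderiv_add_single, pderiv_restrict, ih]

/-! ### Non-standard numbers, points and smooth functions -/

variable {ι : Type u}

/-- The non-standard extension `*S = S^ι / ∼` of a set `S`: families `(sᵢ)` modulo equality almost
everywhere with respect to the ultrafilter `U`. All operations and relations are inherited from `S`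
by representatives. -/
abbrev NonStd (U : Ultrafilter ι) (S : Type*) := Germ (U : Filter ι) S

/-- The absolute value `|⟨zᵢ⟩| = ⟨|zᵢ|⟩`, or the Euclidean norm `‖⟨xᵢ⟩‖ = ⟨‖xᵢ‖⟩`, with values in
`*ℝ`. -/
def absval {U : Ultrafilter ι} {S : Type*} [Norm S] (z : NonStd U S) : NonStd U ℝ :=
  Germ.map (fun a => ‖a‖) z

/-- `x ∈ *ℝ^d` is infinitesimal, `‖x‖ ≈ 0`: its norm is below every standard positive real. -/
def IsInfinitesimal {U : Ultrafilter ι} (x : NonStd U (Eucl d)) : Prop :=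
  ∀ ε : ℝ, 0 < ε → absval x < (ε : NonStd U ℝ)

/-- The monad `μ(X) = {r + dx : r ∈ X, dx ∈ *ℝ^d, ‖dx‖ ≈ 0}` of `X ⊆ ℝ^d`. -/
def monad (U : Ultrafilter ι) (X : Set (Eucl d)) : Set (NonStd U (Eucl d)) :=
  {x | ∃ r ∈ X, ∃ dx : NonStd U (Eucl d), IsInfinitesimal dx ∧ x = (r : NonStd U (Eucl d)) + dx}

/-- The non-standard extension `*X ⊆ *ℝ^d` of `X ⊆ ℝ^d`. -/
def starSet (U : Ultrafilter ι) (X : Set (Eucl d)) : Set (NonStd U (Eucl d)) :=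
  {x | Germ.LiftPred (· ∈ X) x}

theorem monad_mono (U : Ultrafilter ι) {X Y : Set (Eucl d)} (h : X ⊆ Y) :
    monad U X ⊆ monad U Y := by
  rintro x ⟨r, hr, dx, hdx, rfl⟩
  exact ⟨r, h hr, dx, hdx, rfl⟩

theorem monad_subset_starSet (U : Ultrafilter ι) (Ω : Opens (Eucl d)) :
    monad U (Ω : Set (Eucl d)) ⊆ starSet U Ω := by
  rintro x ⟨r, hr, dx, hdx, rfl⟩
  obtain ⟨ε, hε, hb⟩ := Metric.isOpen_iff.1 Ω.2 r hr
  have h := hdx ε hε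
  induction dx using Germ.inductionOn with
  | h v =>
    have h' : ∀ᶠ i in (U : Filter ι), ‖v i‖ < ε := Germ.coe_lt.1 h
    change ∀ᶠ i in (U : Filter ι), r + v i ∈ (Ω : Set (Eucl d))
    filter_upwards [h'] with i hi
    apply hb
    simpa [dist_eq_norm] using hi

/-- The non-standard smooth functions `*𝓔(Ω) = 𝓔(Ω)^ι / ∼`. -/
abbrev NonStdSmooth (U : Ultrafilter ι) (Ω : Opens (Eucl d)) := NonStd U (Smooth Ω)

/-- The value `⟨fᵢ⟩(⟨xᵢ⟩) = ⟨fᵢ(xᵢ)⟩` of a non-standard smooth function at a point of `*Ω`. (Points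
`x ∉ *Ω` give the value `0`, which is never used.) -/
def eval {U : Ultrafilter ι} {Ω : Opens (Eucl d)} (f : NonStdSmooth U Ω)
    (x : NonStd U (Eucl d)) : NonStd U ℂ :=
  Germ.map₂ (fun (g : Smooth Ω) y => extend Ω g y) f x

/-- `∂^α ⟨fᵢ⟩ = ⟨∂^α fᵢ⟩`. -/
def starDeriv {U : Ultrafilter ι} {Ω : Opens (Eucl d)} (α : Fin d → ℕ) :
    NonStdSmooth U Ω →+ NonStdSmooth U Ω where
  toFun := Germ.map (mderiv α)
  map_zero' := congrArg (fun g : Smooth Ω => (g : NonStdSmooth U Ω)) (map_zero (mderiv α))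
  map_add' f g := by
    induction f, g using Germ.inductionOn₂ with
    | h f g => exact congrArg Germ.ofFun (funext fun i => map_add (mderiv α) (f i) (g i))

/-- The restriction `⟨fᵢ⟩ | *𝓞 = ⟨fᵢ | 𝓞⟩` from `*𝓔(Ω)` to `*𝓔(𝓞)`. -/
def starRestrict (U : Ultrafilter ι) {O Ω : Opens (Eucl d)} (h : O ≤ Ω) :
    NonStdSmooth U Ω →+* NonStdSmooth U O where
  toFun := Germ.map (Smooth.restrict h)
  map_one' := rfl
  map_zero' := rfl
  map_add' f g := by
    induction f, g using Germ.inductionOn₂ with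
    | h f g => rfl
  map_mul' f g := by
    induction f, g using Germ.inductionOn₂ with
    | h f g => rfl

section NonStdLemmas

variable {U : Ultrafilter ι} {Ω O : Opens (Eucl d)}

theorem eval_add (f g : NonStdSmooth U Ω) (x : NonStd U (Eucl d)) :
    eval (f + g) x = eval f x + eval g x := by
  induction f, g, x using Germ.inductionOn₃ with
  | H f g x =>
    exact congrArg Germ.ofFun (funext fun i => congrFun (extend_add Ω (f i) (g i)) (x i))

theorem eval_mul (f g : NonStdSmooth U Ω) (x : NonStd U (Eucl d)) :
    eval (f * g) x = eval f x * eval g x := by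
  induction f, g, x using Germ.inductionOn₃ with
  | H f g x =>
    exact congrArg Germ.ofFun (funext fun i => congrFun (extend_mul Ω (f i) (g i)) (x i))

theorem eval_zero (x : NonStd U (Eucl d)) : eval (0 : NonStdSmooth U Ω) x = 0 := by
  have h := eval_add (0 : NonStdSmooth U Ω) 0 x
  rw [add_zero] at h
  exact left_eq_add.1 h

theorem eval_one {x : NonStd U (Eucl d)} (hx : x ∈ starSet U (Ω : Set (Eucl d))) :
    eval (1 : NonStdSmooth U Ω) x = 1 := by
  induction x using Germ.inductionOn with
  | h x =>
    have hx' : ∀ᶠ i in (U : Filter ι), x i ∈ Ω := hx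
    refine Germ.coe_eq.2 ?_
    filter_upwards [hx'] with i hi
    exact extend_of_mem _ hi

theorem eval_neg (f : NonStdSmooth U Ω) (x : NonStd U (Eucl d)) :
    eval (-f) x = -eval f x := by
  have h := eval_add f (-f) x
  rw [add_neg_cancel, eval_zero] at h
  exact eq_neg_of_add_eq_zero_right h.symm

theorem eval_starRestrict (h : O ≤ Ω) (f : NonStdSmooth U Ω) {x : NonStd U (Eucl d)}
    (hx : x ∈ starSet U (O : Set (Eucl d))) : eval (starRestrict U h f) x = eval f x := by
  induction f, x using Germ.inductionOn₂ with
  | h f x =>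
    have hx' : ∀ᶠ i in (U : Filter ι), x i ∈ O := hx
    refine Germ.coe_eq.2 ?_
    filter_upwards [hx'] with i hi
    exact extend_restrict h (f i) hi

theorem starDeriv_zero (f : NonStdSmooth U Ω) : starDeriv 0 f = f := by
  induction f using Germ.inductionOn with
  | h f => exact congrArg Germ.ofFun (funext fun i => by simp [mderiv_zero])

theorem starDeriv_add (α β : Fin d → ℕ) (f : NonStdSmooth U Ω) :
    starDeriv (α + β) f = starDeriv α (starDeriv β f) := by
  induction f using Germ.inductionOn with
  | h f => exact congrArg Germ.ofFun (funext fun i => by simp [mderiv_add])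

theorem starDeriv_single_mul (i : Fin d) (f g : NonStdSmooth U Ω) :
    starDeriv (Pi.single i 1) (f * g) =
      starDeriv (Pi.single i 1) f * g + f * starDeriv (Pi.single i 1) g := by
  induction f, g using Germ.inductionOn₂ with
  | h f g =>
    refine congrArg Germ.ofFun (funext fun j => ?_)
    simp [mderiv_single, pderiv_mul]

theorem starDeriv_starRestrict (h : O ≤ Ω) (α : Fin d → ℕ) (f : NonStdSmooth U Ω) :
    starDeriv α (starRestrict U h f) = starRestrict U h (starDeriv α f) := by
  induction f using Germ.inductionOn with
  | h f => exact congrArg Germ.ofFun (funext fun i => mderiv_restrict h α (f i))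

/-- If all derivatives of `f` take values in `A` and all derivatives of `g` take values in `B`, and
`A * B ⊆ C`, then all derivatives of `f * g` take values in `C`. -/
theorem eval_starDeriv_mul_mem {A B : Set (NonStd U ℂ)} {C : AddSubgroup (NonStd U ℂ)}
    (hAB : ∀ a ∈ A, ∀ b ∈ B, a * b ∈ C) {x : NonStd U (Eucl d)} (α : Fin d → ℕ)
    (f g : NonStdSmooth U Ω) (hf : ∀ β, eval (starDeriv β f) x ∈ A)
    (hg : ∀ β, eval (starDeriv β g) x ∈ B) : eval (starDeriv α (f * g)) x ∈ C := by
  induction α using multiindex_induction generalizing f g with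
  | h0 =>
    have h1 := hf 0
    have h2 := hg 0
    rw [starDeriv_zero] at h1 h2 ⊢
    rw [eval_mul]
    exact hAB _ h1 _ h2
  | h1 α i ih =>
    rw [starDeriv_add, starDeriv_single_mul, map_add, eval_add]
    refine C.add_mem (ih _ _ (fun β => ?_) hg) (ih _ _ hf fun β => ?_)
    · rw [← starDeriv_add]; exact hf _
    · rw [← starDeriv_add]; exact hg _

theorem starDeriv_one {α : Fin d → ℕ} {x : NonStd U (Eucl d)}
    (hx : x ∈ starSet U (Ω : Set (Eucl d))) :
    eval (starDeriv α (1 : NonStdSmooth U Ω)) x = 0 ∨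
      eval (starDeriv α (1 : NonStdSmooth U Ω)) x = 1 := by
  induction α using multiindex_induction with
  | h0 => right; rw [starDeriv_zero, eval_one hx]
  | h1 α i ih =>
    left
    have h := starDeriv_single_mul i (1 : NonStdSmooth U Ω) 1
    rw [mul_one, mul_one, one_mul] at h
    rw [starDeriv_add, left_eq_add.1 h, map_zero, eval_zero]

theorem absval_mul (z w : NonStd U ℂ) : absval (z * w) = absval z * absval w := by
  induction z, w using Germ.inductionOn₂ with
  | h z w => exact congrArg Germ.ofFun (funext fun i => norm_mul (z i) (w i))

theorem absval_inv (z : NonStd U ℂ) : absval z⁻¹ = (absval z)⁻¹ := by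
  induction z using Germ.inductionOn with
  | h z => exact congrArg Germ.ofFun (funext fun i => norm_inv (z i))

theorem absval_add_le (z w : NonStd U ℂ) : absval (z + w) ≤ absval z + absval w := by
  induction z, w using Germ.inductionOn₂ with
  | h z w => exact Germ.coe_le.2 (Eventually.of_forall fun i => norm_add_le (z i) (w i))

theorem absval_two : absval (2 : NonStd U ℂ) = 2 := by
  change ((‖(2 : ℂ)‖ : ℝ) : NonStd U ℝ) = ((2 : ℝ) : NonStd U ℝ)
  simp

theorem absval_nonneg (z : NonStd U ℂ) : 0 ≤ absval z := by
  induction z using Germ.inductionOn with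
  | h z => exact Germ.coe_le.2 (Eventually.of_forall fun i => norm_nonneg (z i))

theorem absval_neg (z : NonStd U ℂ) : absval (-z) = absval z := by
  induction z using Germ.inductionOn with
  | h z => exact congrArg Germ.ofFun (funext fun i => norm_neg (z i))

theorem absval_pos {z : NonStd U ℂ} (hz : z ≠ 0) : 0 < absval z := by
  refine lt_of_le_of_ne (absval_nonneg z) fun h => ?_
  have h1 : absval z * absval z⁻¹ = 1 := by
    rw [← absval_mul, mul_inv_cancel₀ hz]
    change ((‖(1 : ℂ)‖ : ℝ) : NonStd U ℝ) = ((1 : ℝ) : NonStd U ℝ)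
    simp
  rw [← h, zero_mul] at h1
  exact zero_ne_one h1

end NonStdLemmas

/-! ### Convex subrings of `*ℂ` -/

/-- A convex subring `𝓜` of `*ℂ`: `|z| ≤ |ζ|` and `ζ ∈ 𝓜` imply `z ∈ 𝓜`. -/
structure ConvexSubring (U : Ultrafilter ι) extends Subring (NonStd U ℂ) where
  convex' : ∀ z ζ : NonStd U ℂ, ζ ∈ carrier → absval z ≤ absval ζ → z ∈ carrier

/-- The set `𝓜₀ = {z ∈ 𝓜 : z = 0 or 1/z ∉ 𝓜}` of non-invertible elements of `𝓜`, which is an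
additive subgroup (indeed an ideal of `𝓜`). -/
def ConvexSubring.nonInv {U : Ultrafilter ι} (M : ConvexSubring U) :
    AddSubgroup (NonStd U ℂ) where
  carrier := {z | z ∈ M.toSubring ∧ (z = 0 ∨ z⁻¹ ∉ M.toSubring)}
  zero_mem' := ⟨zero_mem _, Or.inl rfl⟩
  neg_mem' := by
    rintro z ⟨h1, h2⟩
    refine ⟨neg_mem h1, ?_⟩
    rwa [neg_eq_zero, inv_neg, neg_mem_iff]
  add_mem' := by
    have key : ∀ z w : NonStd U ℂ, (w = 0 ∨ w⁻¹ ∉ M.toSubring) → absval z ≤ absval w →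
        z + w ≠ 0 → (z + w)⁻¹ ∈ M.toSubring → False := by
      intro z w hw hzw h0 hinv
      have hw0 : w ≠ 0 := by
        rintro rfl
        have h1 : absval (z + 0) ≤ absval (0 : NonStd U ℂ) := by rwa [add_zero]
        have h2 : absval (0 : NonStd U ℂ) = 0 := by
          change ((‖(0 : ℂ)‖ : ℝ) : NonStd U ℝ) = ((0 : ℝ) : NonStd U ℝ)
          simp
        exact absurd (absval_pos h0) (not_lt.2 (h2 ▸ h1))
      refine hw.elim hw0 fun hw' => hw' ?_
      refine M.convex' _ (2 * (z + w)⁻¹) (M.toSubring.mul_mem ?_ hinv) ?_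
      · have := M.toSubring.add_mem M.toSubring.one_mem M.toSubring.one_mem
        rwa [one_add_one_eq_two] at this
      · have p1 := absval_pos h0
        have p2 := absval_pos hw0
        rw [absval_mul, absval_inv, absval_inv, absval_two, ← div_eq_mul_inv, inv_eq_one_div,
          div_le_div_iff₀ p2 p1, one_mul]
        calc absval (z + w) ≤ absval z + absval w := absval_add_le z w
          _ ≤ absval w + absval w := by gcongr
          _ = 2 * absval w := (two_mul _).symm
    rintro z w ⟨hz1, hz2⟩ ⟨hw1, hw2⟩
    refine ⟨add_mem hz1 hw1, ?_⟩
    by_contra! hc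
    rcases le_total (absval z) (absval w) with h | h
    · exact key z w hw2 h hc.1 hc.2
    · rw [add_comm] at hc
      exact key w z hz2 h hc.1 hc.2

theorem ConvexSubring.mul_nonInv {U : Ultrafilter ι} (M : ConvexSubring U) :
    ∀ z ∈ (M.toSubring : Set (NonStd U ℂ)), ∀ w ∈ (M.nonInv : Set (NonStd U ℂ)),
      z * w ∈ M.nonInv := by
  rintro z hz w ⟨hw1, hw2⟩
  refine ⟨M.toSubring.mul_mem hz hw1, ?_⟩
  by_contra! hc
  have hw0 : w ≠ 0 := right_ne_zero_of_mul hc.1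
  have hz0 : z ≠ 0 := left_ne_zero_of_mul hc.1
  refine hw2.elim hw0 fun h => h ?_
  have := M.toSubring.mul_mem hz hc.2
  rwa [mul_inv, ← mul_assoc, mul_inv_cancel₀ hz0, one_mul] at this

/-! ### `𝓜`-asymptotic functions -/

section Asymptotic

variable {U : Ultrafilter ι}

/-- The `𝓜`-moderate functions
`𝓜(Ω) = {f ∈ *𝓔(Ω) : ∂^α f(x) ∈ 𝓜 for all α ∈ ℕ₀^d and x ∈ μ(Ω)}`. -/
def moderate (M : ConvexSubring U) (Ω : Opens (Eucl d)) : Subring (NonStdSmooth U Ω) where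
  carrier := {f | ∀ α : Fin d → ℕ, ∀ x ∈ monad U (Ω : Set (Eucl d)),
    eval (starDeriv α f) x ∈ M.toSubring}
  zero_mem' α x _ := by rw [map_zero, eval_zero]; exact zero_mem _
  one_mem' α x hx := by
    rcases starDeriv_one (α := α) (monad_subset_starSet U Ω hx) with h | h
    · rw [h]; exact zero_mem _
    · rw [h]; exact one_mem _
  add_mem' hf hg α x hx := by
    rw [map_add, eval_add]; exact add_mem (hf α x hx) (hg α x hx)
  neg_mem' hf α x hx := by
    rw [map_neg, eval_neg]; exact neg_mem (hf α x hx)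
  mul_mem' {f g} hf hg α x hx :=
    eval_starDeriv_mul_mem (A := M.toSubring) (B := M.toSubring)
      (C := M.toSubring.toAddSubgroup) (fun _ ha _ hb => M.toSubring.mul_mem ha hb) α f g
      (fun β => hf β x hx) (fun β => hg β x hx)

/-- The `𝓜`-negligible functions
`𝓜₀(Ω) = {f ∈ *𝓔(Ω) : ∂^α f(x) ∈ 𝓜₀ for all α ∈ ℕ₀^d and x ∈ μ(Ω)}`, as an ideal of `𝓜(Ω)`. (They
are moderate since `𝓜₀ ⊆ 𝓜`.) -/
def negligible (M : ConvexSubring U) (Ω : Opens (Eucl d)) : Ideal (moderate M Ω) where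
  carrier := {f | ∀ α : Fin d → ℕ, ∀ x ∈ monad U (Ω : Set (Eucl d)),
    eval (starDeriv α (f : NonStdSmooth U Ω)) x ∈ M.nonInv}
  zero_mem' α x _ := by
    change eval (starDeriv α (0 : NonStdSmooth U Ω)) x ∈ _
    rw [map_zero, eval_zero]; exact zero_mem _
  add_mem' {f g} hf hg α x hx := by
    change eval (starDeriv α ((f : NonStdSmooth U Ω) + (g : NonStdSmooth U Ω))) x ∈ _
    rw [map_add, eval_add]; exact add_mem (hf α x hx) (hg α x hx)
  smul_mem' f g hg α x hx := by
    change eval (starDeriv α ((f : NonStdSmooth U Ω) * (g : NonStdSmooth U Ω))) x ∈ M.nonInv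
    exact eval_starDeriv_mul_mem M.mul_nonInv α (f : NonStdSmooth U Ω) (g : NonStdSmooth U Ω)
      (fun β => f.2 β x hx) (fun β => hg β x hx)

/-- The ring `𝓜(Ω)/𝓜₀(Ω)` of `𝓜`-asymptotic functions on `Ω`. -/
def Asymp (M : ConvexSubring U) (Ω : Opens (Eucl d)) := moderate M Ω ⧸ negligible M Ω

instance (M : ConvexSubring U) (Ω : Opens (Eucl d)) : CommRing (Asymp M Ω) :=
  inferInstanceAs (CommRing (moderate M Ω ⧸ negligible M Ω))

/-- The quotient map `f ↦ f̂` from `𝓜(Ω)` onto the ring of asymptotic functions. -/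
def toAsymp (M : ConvexSubring U) (Ω : Opens (Eucl d)) : moderate M Ω →+* Asymp M Ω :=
  Ideal.Quotient.mk (negligible M Ω)

theorem toAsymp_surjective (M : ConvexSubring U) (Ω : Opens (Eucl d)) :
    Function.Surjective (toAsymp M Ω) := Ideal.Quotient.mk_surjective

theorem toAsymp_eq_zero_iff {M : ConvexSubring U} {Ω : Opens (Eucl d)} (f : moderate M Ω) :
    toAsymp M Ω f = 0 ↔ f ∈ negligible M Ω := Ideal.Quotient.eq_zero_iff_mem

/-- `∂^α` on `𝓜(Ω)`. -/
def modDeriv (M : ConvexSubring U) (Ω : Opens (Eucl d)) (α : Fin d → ℕ) :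
    moderate M Ω →+ moderate M Ω where
  toFun f := ⟨starDeriv α (f : NonStdSmooth U Ω), fun β x hx => by
    rw [← starDeriv_add]; exact f.2 (β + α) x hx⟩
  map_zero' := Subtype.ext (map_zero (starDeriv α))
  map_add' f g := Subtype.ext (map_add (starDeriv α) (f : NonStdSmooth U Ω) g)

/-- `∂^α` of the class of `f` is the class of `∂^α f`. -/
def asympDeriv {M : ConvexSubring U} {Ω : Opens (Eucl d)} (α : Fin d → ℕ) :
    Asymp M Ω → Asymp M Ω :=
  Quotient.map' (modDeriv M Ω α) fun f g h => by
    rw [Submodule.quotientRel_def] at h ⊢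
    intro β x hx
    have h1 := h (β + α) x hx
    rw [starDeriv_add] at h1
    rw [← map_sub]
    exact h1

/-- The restriction `f ↦ f|*𝓞` from `𝓜(Ω)` to `𝓜(𝓞)`. -/
def modRestrict (M : ConvexSubring U) {O Ω : Opens (Eucl d)} (h : O ≤ Ω) :
    moderate M Ω →+* moderate M O :=
  RingHom.codRestrict ((starRestrict U h).comp (moderate M Ω).subtype) (moderate M O)
    fun f α x hx => by
      change eval (starDeriv α (starRestrict U h (f : NonStdSmooth U Ω))) x ∈ _
      rw [starDeriv_starRestrict, eval_starRestrict h _ (monad_subset_starSet U O hx)]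
      exact f.2 α x (monad_mono U h hx)

theorem modRestrict_mem {M : ConvexSubring U} {O Ω : Opens (Eucl d)} (h : O ≤ Ω)
    (f : moderate M Ω) (hf : f ∈ negligible M Ω) : modRestrict M h f ∈ negligible M O := by
  intro α x hx
  have h1 : eval (starDeriv α (f : NonStdSmooth U Ω)) x ∈ M.nonInv := hf α x (monad_mono U h hx)
  have h2 : ((modRestrict M h f : moderate M O) : NonStdSmooth U O) =
    starRestrict U h (f : NonStdSmooth U Ω) := rfl
  rw [h2, starDeriv_starRestrict, eval_starRestrict h _ (monad_subset_starSet U O hx)]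
  exact h1

theorem negligible_le_comap (M : ConvexSubring U) {O Ω : Opens (Eucl d)} (h : O ≤ Ω) :
    negligible M Ω ≤ (negligible M O).comap (modRestrict M h) :=
  fun f hf => modRestrict_mem h f hf

/-- The restriction of asymptotic functions: the class of `f` goes to the class of `f|*𝓞`. -/
def restrict {M : ConvexSubring U} {O Ω : Opens (Eucl d)} (h : O ≤ Ω) :
    Asymp M Ω →+* Asymp M O :=
  Ideal.quotientMap (I := negligible M Ω) (negligible M O) (modRestrict M h)
    (negligible_le_comap M h)

theorem restrict_mk {M : ConvexSubring U} {O Ω : Opens (Eucl d)} (h : O ≤ Ω)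
    (f : moderate M Ω) :
    restrict h (toAsymp M Ω f) =
      toAsymp M O (modRestrict M h f) := rfl

theorem asympDeriv_mk {M : ConvexSubring U} {Ω : Opens (Eucl d)} (α : Fin d → ℕ)
    (f : moderate M Ω) :
    asympDeriv α (toAsymp M Ω f) =
      toAsymp M Ω (modDeriv M Ω α f) := rfl

/-- The open subsets of `Ω` on which the asymptotic function `f` vanishes. -/
def vanishingOpens {M : ConvexSubring U} {Ω : Opens (Eucl d)} (f : Asymp M Ω) :
    Set (Opens (Eucl d)) :=
  {O | ∃ h : O ≤ Ω, restrict h f = 0}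

/-- The (standard) support of `f`: the complement in `Ω` of the union of all open subsets of `Ω` on
which `f` vanishes. -/
def supp {M : ConvexSubring U} {Ω : Opens (Eucl d)} (f : Asymp M Ω) : Set (Eucl d) :=
  (Ω : Set (Eucl d)) \ (sSup (vanishingOpens f) : Opens (Eucl d))

end Asymptotic

/-- The members of an open covering of `Ω` are contained in `Ω`. -/
theorem le_of_cover {Λ : Type*} {Ωs : Λ → Opens (Eucl d)} {Ω : Opens (Eucl d)}
    (h : ⨆ l, Ωs l = Ω) (l : Λ) : Ωs l ≤ Ω := h ▸ le_iSup Ωs l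

end AsymptoticFunctions

end

open AsymptoticFunctions

namespace AsymptoticFunctions

universe u v

open scoped Manifold

/-! ### Smooth partitions of unity on an open set, and gluing of standard functions. -/

section Gluing

variable {d : ℕ}

/-! Everything rests on the shape of the monad: a point of `μ(Ω)` is infinitely close to some
standard `r ∈ Ω`, and it then lies in `μ(V)` for every neighbourhood `V` of `r` (`monad_local`).
Moderateness and negligibility are tested pointwise on monads, so both are local conditions
(`mem_moderate_of_local`, `eq_zero_of_local`). This gives (iii) and the largest open set on which a
class vanishes.

For (iv), take a standard smooth partition of unity `ψ` on `Ω` subordinate to the covering and glue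
representatives to `∑ ψₗ fₗ`, separately at each index `i`. By `exists_smooth_gluing` every `r ∈ Ω`
has a neighbourhood `V` on which the sum runs over a finite set `F` of labels, and `V` and `F` do
not depend on the functions being glued. They are therefore the same for all `i`, and the finite
formula passes to the ultrapower. A convex subring contains all finite numbers, so the standard
functions `ψₗ` are moderate, and the glued function is locally a finite sum of products of moderate
functions (`exists_asymp_gluing`). On `V ∩ Ωₗ` compatibility turns each class in that sum into `fₗ`,
the coefficients add up to `1`, and locality finishes the argument (`exists_restrict_eq`).

The remaining identities hold already for representatives. -/

/-- Smoothness is a local property. -/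
theorem mem_smooth_of_locally_eq {Ω : Opens (Eucl d)} {f : Ω → ℂ}
    (h : ∀ r ∈ Ω, ∃ g : Eucl d → ℂ, ContDiffAt ℝ ∞ g r ∧ extend Ω f =ᶠ[𝓝 r] g) :
    f ∈ Smooth Ω := by
  change ContDiffOn ℝ ∞ (extend Ω f) (Ω : Set (Eucl d))
  intro r hr
  obtain ⟨g, hg, hfg⟩ := h r hr
  exact (hg.congr_of_eventuallyEq hfg).contDiffWithinAt

/-- Smooth functions on the manifold `Ω` are elements of `Smooth Ω`. -/
theorem mem_smooth_of_contMDiff {Ω : Opens (Eucl d)} {φ : Ω → ℝ}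
    (hφ : ContMDiff 𝓘(ℝ, Eucl d) 𝓘(ℝ, ℝ) ∞ φ) : (fun x => (φ x : ℂ)) ∈ Smooth Ω := by
  change ContDiffOn ℝ ∞ (extend Ω fun x => (φ x : ℂ)) (Ω : Set (Eucl d))
  intro r hr
  have h1 : ContMDiff 𝓘(ℝ, Eucl d) 𝓘(ℝ, ℂ) ∞ fun x : Ω => (φ x : ℂ) :=
    (Complex.ofRealCLM.contDiff.contMDiff (n := ∞)).comp hφ
  -- Written as an ambient function composed with the inclusion, so that `contMDiffAt_subtype_iff`
  -- moves smoothness from the manifold `Ω` to `ℝ^d`.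
  have h2 : (fun x : Ω => (φ x : ℂ)) =
      fun x : Ω => extend Ω (fun x => (φ x : ℂ)) x :=
    funext fun x => (extend_of_mem (fun x : Ω => (φ x : ℂ)) x.2).symm
  rw [h2] at h1
  have h3 := contMDiffAt_subtype_iff.1 (h1 ⟨r, hr⟩)
  exact (contMDiffAt_iff_contDiffAt.1 h3).contDiffWithinAt

/-- A smooth partition of unity subordinate to an open covering of `Ω`, together with the gluing
`g ↦ ∑ ψₗ gₗ` of families of smooth functions on the members of the covering. -/
theorem exists_smooth_gluing {Λ : Type v} (Ωs : Λ → Opens (Eucl d)) (Ω : Opens (Eucl d))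
    (hcov : ⨆ l, Ωs l = Ω) :
    ∃ (ψ : Λ → Smooth Ω) (G : (∀ l, Smooth (Ωs l)) → Smooth Ω), ∀ r ∈ Ω,
      ∃ (V : Opens (Eucl d)) (_ : r ∈ V) (hV : V ≤ Ω) (F : Finset Λ) (hF : ∀ l ∈ F, V ≤ Ωs l),
        (∑ l : F, Smooth.restrict hV (ψ l) = 1) ∧
        ∀ g, Smooth.restrict hV (G g) =
          ∑ l : F, Smooth.restrict hV (ψ l) * Smooth.restrict (hF l l.2) (g l) := by
  -- The partition lives on the manifold `Ω` itself: supports are closed only in `Ω`, and the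
  -- functions need not extend smoothly to `ℝ^d`.
  have : LocallyCompactSpace Ω := Ω.2.locallyCompactSpace
  obtain ⟨ρ, hρ⟩ := SmoothPartitionOfUnity.exists_isSubordinate 𝓘(ℝ, Eucl d)
    (isClosed_univ (X := Ω)) (fun l => ((↑) ⁻¹' (Ωs l : Set (Eucl d)) : Set Ω))
    (fun l => (Ωs l).2.preimage continuous_subtype_val) (by
      intro x _
      have hx : (x : Eucl d) ∈ ⨆ l, Ωs l := hcov ▸ x.2
      obtain ⟨l, hl⟩ := Opens.mem_iSup.1 hx
      exact Set.mem_iUnion.2 ⟨l, hl⟩)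
  have hloc : ∀ r ∈ Ω, ∃ (V : Opens (Eucl d)) (_ : r ∈ V) (_ : V ≤ Ω) (F : Finset Λ),
      (∀ l ∈ F, V ≤ Ωs l) ∧ ∀ x : Ω, (x : Eucl d) ∈ V → ∀ l ∉ F, ρ l x = 0 := by
    intro r hr
    -- The labels whose closed support contains `r`. Closed supports serve both purposes: the other
    -- functions vanish near `r`, and subordination puts `r` in the open set `Ωs l` for each `l ∈
    -- F`.
    set F := ρ.fintsupport ⟨r, hr⟩ with hFdef
    have h1 : ∀ᶠ y : Ω in 𝓝 ⟨r, hr⟩, ∀ l ∉ F, ρ l y = 0 := by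
      filter_upwards [ρ.eventually_finsupport_subset ⟨r, hr⟩] with y hy l hl
      by_contra hc
      exact hl (hy (ρ.mem_finsupport y |>.2 hc))
    have h2 : ∀ᶠ y : Ω in 𝓝 ⟨r, hr⟩, ∀ l ∈ F, (y : Eucl d) ∈ Ωs l := by
      rw [Filter.eventually_all_finset]
      intro l hl
      have : (⟨r, hr⟩ : Ω) ∈ tsupport (ρ l) := (ρ.mem_fintsupport_iff _ l).1 hl
      exact ((Ωs l).2.preimage continuous_subtype_val).mem_nhds (hρ l this)
    obtain ⟨W, hW, hWo, hrW⟩ := eventually_nhds_iff.1 (h1.and h2)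
    refine ⟨⟨(↑) '' W, Ω.2.isOpenMap_subtype_val W hWo⟩, ⟨_, hrW, rfl⟩, ?_, F, ?_, ?_⟩
    · rintro _ ⟨y, -, rfl⟩
      exact y.2
    · rintro l hl _ ⟨y, hy, rfl⟩
      exact (hW y hy).2 l hl
    · rintro x ⟨y, hy, hyx⟩ l hl
      rw [← Subtype.ext hyx]
      exact (hW y hy).1 l hl
  have hψ : ∀ l, (fun x => (ρ l x : ℂ)) ∈ Smooth Ω := fun l =>
    mem_smooth_of_contMDiff (ρ l).contMDiff
  -- On `V` only the labels in `F` contribute, so the arbitrary value `0` of `extend` off `Ωs l`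
  -- never matters when `V ≤ Ωs l` for these labels.
  have hsum : ∀ (V : Opens (Eucl d)) (F : Finset Λ),
      (∀ x : Ω, (x : Eucl d) ∈ V → ∀ l ∉ F, ρ l x = 0) →
      ∀ (g : ∀ l, Smooth (Ωs l)) (x : Ω), (x : Eucl d) ∈ V →
        ∑ᶠ l, (ρ l x : ℂ) * extend (Ωs l) (g l) x =
          ∑ l ∈ F, (ρ l x : ℂ) * extend (Ωs l) (g l) x := by
    intro V F h0 g x hx
    refine finsum_eq_sum_of_support_subset _ fun l hl => ?_
    by_contra hc
    exact hl (by simp [h0 x hx l hc])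
  have hG : ∀ g : ∀ l, Smooth (Ωs l),
      (fun x : Ω => ∑ᶠ l, (ρ l x : ℂ) * extend (Ωs l) (g l) x) ∈ Smooth Ω := by
    intro g
    refine mem_smooth_of_locally_eq fun r hr => ?_
    obtain ⟨V, hrV, hV, F, hF, h0⟩ := hloc r hr
    refine ⟨fun x => ∑ l ∈ F, extend Ω (fun x => (ρ l x : ℂ)) x * extend (Ωs l) (g l) x,
      ContDiffAt.sum fun l hl => ?_, ?_⟩
    · exact (smooth_contDiffAt ⟨_, hψ l⟩ hr).mul (smooth_contDiffAt (g l) (hF l hl hrV))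
    · filter_upwards [V.2.mem_nhds hrV] with x hx
      rw [extend_of_mem _ (hV hx), hsum V F h0 g ⟨x, hV hx⟩ hx]
      exact Finset.sum_congr rfl fun l _ => by rw [extend_of_mem _ (hV hx)]
  refine ⟨fun l => ⟨_, hψ l⟩, fun g => ⟨_, hG g⟩, fun r hr => ?_⟩
  obtain ⟨V, hrV, hV, F, hF, h0⟩ := hloc r hr
  refine ⟨V, hrV, hV, F, hF, ?_, fun g => ?_⟩
  · ext x
    have h1 := ρ.sum_eq_one (Set.mem_univ (⟨x, hV x.2⟩ : Ω))
    rw [finsum_eq_sum_of_support_subset (s := F) _ fun l hl => by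
      by_contra hc
      exact hl (h0 ⟨x, hV x.2⟩ x.2 l hc)] at h1
    rw [AddSubmonoidClass.coe_finsetSum, Finset.sum_apply]
    change ∑ l : F, ((ρ l ⟨x, hV x.2⟩ : ℝ) : ℂ) = 1
    rw [Finset.sum_coe_sort F fun l => ((ρ l ⟨x, hV x.2⟩ : ℝ) : ℂ)]
    exact_mod_cast h1
  · ext x
    rw [AddSubmonoidClass.coe_finsetSum, Finset.sum_apply]
    refine (hsum V F h0 g ⟨x, hV x.2⟩ x.2).trans ?_
    rw [← Finset.sum_coe_sort]
    refine Finset.sum_congr rfl fun l _ => ?_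
    change _ = (ρ l ⟨x, hV x.2⟩ : ℂ) * (g l : Ωs l → ℂ) ⟨x, hF l l.2 x.2⟩
    rw [extend_of_mem _ (hF l l.2 x.2)]

end Gluing

/-! ### Locality of moderate and negligible functions. -/

section Sheaf

variable {d : ℕ} {ι : Type u} {U : Ultrafilter ι}

/-- Source of all locality: whether `r + dx` belongs to a monad can be certified by its standard
part `r` alone, however small the neighbourhood of `r`. -/
theorem monad_local {x : NonStd U (Eucl d)} {X : Set (Eucl d)} (hx : x ∈ monad U X) :
    ∃ r ∈ X, ∀ Y : Set (Eucl d), r ∈ Y → x ∈ monad U Y := by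
  obtain ⟨r, hr, dx, hdx, rfl⟩ := hx
  exact ⟨r, hr, fun Y hY => ⟨r, hY, dx, hdx, rfl⟩⟩

theorem eval_starDeriv_starRestrict {O Ω : Opens (Eucl d)} (h : O ≤ Ω) (α : Fin d → ℕ)
    (f : NonStdSmooth U Ω) {x : NonStd U (Eucl d)} (hx : x ∈ monad U (O : Set (Eucl d))) :
    eval (starDeriv α (starRestrict U h f)) x = eval (starDeriv α f) x := by
  rw [starDeriv_starRestrict, eval_starRestrict h _ (monad_subset_starSet U O hx)]

/-- Moderateness is a local property. -/
theorem mem_moderate_of_local {M : ConvexSubring U} {Ω : Opens (Eucl d)} {f : NonStdSmooth U Ω}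
    (h : ∀ r ∈ Ω, ∃ (V : Opens (Eucl d)) (_ : r ∈ V) (hV : V ≤ Ω),
      starRestrict U hV f ∈ moderate M V) : f ∈ moderate M Ω := by
  intro α x hx
  obtain ⟨r, hr, hx'⟩ := monad_local hx
  obtain ⟨V, hrV, hV, hf⟩ := h r hr
  rw [← eval_starDeriv_starRestrict hV α f (hx' V hrV)]
  exact hf α x (hx' V hrV)

/-- An asymptotic function that vanishes locally is zero. -/
theorem eq_zero_of_local {M : ConvexSubring U} {Ω : Opens (Eucl d)} {f : Asymp M Ω}
    (h : ∀ r ∈ Ω, ∃ (V : Opens (Eucl d)) (_ : r ∈ V) (hV : V ≤ Ω), restrict hV f = 0) :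
    f = 0 := by
  obtain ⟨f, rfl⟩ := toAsymp_surjective M Ω f
  rw [toAsymp_eq_zero_iff]
  intro α x hx
  obtain ⟨r, hr, hx'⟩ := monad_local hx
  obtain ⟨V, hrV, hV, hf⟩ := h r hr
  rw [restrict_mk, toAsymp_eq_zero_iff] at hf
  rw [← eval_starDeriv_starRestrict hV α _ (hx' V hrV)]
  exact hf α x (hx' V hrV)

theorem restrict_restrict {M : ConvexSubring U} {Ω₁ Ω₂ Ω : Opens (Eucl d)} (h₁ : Ω₁ ≤ Ω₂)
    (h₂ : Ω₂ ≤ Ω) (f : Asymp M Ω) :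
    restrict h₁ (restrict h₂ f) = restrict (h₁.trans h₂) f := by
  obtain ⟨f, rfl⟩ := toAsymp_surjective M Ω f
  rw [restrict_mk, restrict_mk, restrict_mk]
  congr 1
  refine Subtype.ext ?_
  obtain ⟨f, hf⟩ := f
  induction f using Germ.inductionOn with
  | h f => rfl

theorem restrict_rfl {M : ConvexSubring U} {Ω : Opens (Eucl d)} (f : Asymp M Ω) :
    restrict le_rfl f = f := by
  obtain ⟨f, rfl⟩ := toAsymp_surjective M Ω f
  rw [restrict_mk]
  congr 1
  refine Subtype.ext ?_
  obtain ⟨f, hf⟩ := f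
  induction f using Germ.inductionOn with
  | h f => rfl

/-! ### Standard smooth functions as moderate functions. -/

/-- Every finite non-standard number belongs to every convex subring. -/
theorem ConvexSubring.mem_of_absval_le_natCast (M : ConvexSubring U) {z : NonStd U ℂ} (n : ℕ)
    (h : absval z ≤ ((n : ℝ) : NonStd U ℝ)) : z ∈ M.toSubring := by
  -- A subring with `1` contains every natural number, and convexity then captures all that is
  -- bounded by one.
  refine M.convex' z ((n : ℂ) : NonStd U ℂ) (natCast_mem M.toSubring n) (h.trans_eq ?_)
  exact congrArg Germ.ofFun (funext fun i => (Complex.norm_natCast n).symm)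

/-- Standard smooth functions have finite values on the monad of their domain. -/
theorem eval_const_mem (M : ConvexSubring U) {Ω : Opens (Eucl d)} (f : Smooth Ω)
    {x : NonStd U (Eucl d)} (hx : x ∈ monad U (Ω : Set (Eucl d))) :
    eval (f : NonStdSmooth U Ω) x ∈ M.toSubring := by
  obtain ⟨r, hr, dx, hdx, rfl⟩ := hx
  obtain ⟨n, hn⟩ := exists_nat_gt ‖extend Ω f r‖
  refine M.mem_of_absval_le_natCast n ?_
  -- Continuity at the standard point `r` keeps the bound on a ball of standard radius, which
  -- contains `r + dx` for `U`-almost all indices.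
  have hc : ∀ᶠ y in 𝓝 r, ‖extend Ω f y‖ < n :=
    (smooth_contDiffAt f hr).continuousAt.norm.eventually_lt_const hn
  obtain ⟨ε, hε, hb⟩ := Metric.eventually_nhds_iff.1 hc
  have h := hdx ε hε
  induction dx using Germ.inductionOn with
  | h v =>
    have h' : ∀ᶠ i in (U : Filter ι), ‖v i‖ < ε := Germ.coe_lt.1 h
    refine Germ.coe_le.2 ?_
    filter_upwards [h'] with i hi
    exact (hb (by simpa [dist_eq_norm] using hi)).le

/-- Standard smooth functions are moderate. -/
theorem const_mem_moderate (M : ConvexSubring U) {Ω : Opens (Eucl d)} (f : Smooth Ω) :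
    (f : NonStdSmooth U Ω) ∈ moderate M Ω :=
  -- A derivative of a standard function is again standard, so the bound on values suffices.
  fun α _ hx => eval_const_mem M (mderiv α f) hx

/-- The class of a standard smooth function. -/
noncomputable def constAsymp (M : ConvexSubring U) (Ω : Opens (Eucl d)) : Smooth Ω →+* Asymp M Ω :=
  (toAsymp M Ω).comp
    { toFun := fun f => ⟨(f : NonStdSmooth U Ω), const_mem_moderate M f⟩
      map_one' := rfl
      map_mul' := fun _ _ => rfl
      map_zero' := rfl
      map_add' := fun _ _ => rfl }

theorem restrict_constAsymp {M : ConvexSubring U} {O Ω : Opens (Eucl d)} (h : O ≤ Ω)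
    (f : Smooth Ω) :
    restrict h (constAsymp M Ω f) = constAsymp M O (Smooth.restrict h f) := rfl

/-! ### Gluing of asymptotic functions. -/

/-- Gluing of asymptotic functions along a partition of unity: there is an asymptotic function that
is locally `∑ ψₗ fₗ`. -/
theorem exists_asymp_gluing (M : ConvexSubring U) {Λ : Type v} (Ωs : Λ → Opens (Eucl d))
    (Ω : Opens (Eucl d)) (hcov : ⨆ l, Ωs l = Ω) (fs : ∀ l, Asymp M (Ωs l)) :
    ∃ f : Asymp M Ω, ∀ r ∈ Ω, ∃ (V : Opens (Eucl d)) (_ : r ∈ V) (hV : V ≤ Ω) (F : Finset Λ)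
      (hF : ∀ l ∈ F, V ≤ Ωs l) (ψ : F → Asymp M V),
        ∑ l, ψ l = 1 ∧ restrict hV f = ∑ l, ψ l * restrict (hF l l.2) (fs l) := by
  obtain ⟨ψ, G, hG⟩ := exists_smooth_gluing Ωs Ω hcov
  choose f hf using fun l => toAsymp_surjective M (Ωs l) (fs l)
  -- Representing sequences are fixed for all labels at once, so that at each index `i` there is a
  -- full family `a l i` to which `G` applies.
  choose a ha using fun l => Quotient.exists_rep (f l : NonStdSmooth U (Ωs l))
  let g : NonStdSmooth U Ω := ((fun i => G fun l => a l i : ι → Smooth Ω) : NonStdSmooth U Ω)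
  -- The hypothesis holds for all families `b` with the same `V` and `F`. Applied to every index
  -- `i`, it yields one finite sum in the ultrapower, whatever the size of the covering.
  have hloc : ∀ (V : Opens (Eucl d)) (hV : V ≤ Ω) (F : Finset Λ) (hF : ∀ l ∈ F, V ≤ Ωs l),
      (∀ b, Smooth.restrict hV (G b) =
        ∑ l : F, Smooth.restrict hV (ψ l) * Smooth.restrict (hF l l.2) (b l)) →
      starRestrict U hV g = ((∑ l : F,
        ⟨(Smooth.restrict hV (ψ l) : NonStdSmooth U V), const_mem_moderate M _⟩ *
          modRestrict M (hF l l.2) (f l) : moderate M V) : NonStdSmooth U V) := by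
    intro V hV F hF h
    have h1 : starRestrict U hV g =
        Germ.coeRingHom (U : Filter ι) (∑ l : F, (fun i => Smooth.restrict hV (ψ l) *
          Smooth.restrict (hF l l.2) (a l i) : ι → Smooth V)) := by
      refine congrArg Germ.ofFun (funext fun i => ?_)
      rw [Finset.sum_apply]
      exact h _
    rw [h1, map_sum, AddSubmonoidClass.coe_finsetSum]
    refine Finset.sum_congr rfl fun l _ => ?_
    change _ = (Smooth.restrict hV (ψ l) : NonStdSmooth U V) *
      starRestrict U (hF l l.2) (f l : NonStdSmooth U (Ωs l))
    rw [← ha l]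
    rfl
  have hg : g ∈ moderate M Ω := by
    refine mem_moderate_of_local fun r hr => ?_
    obtain ⟨V, hrV, hV, F, hF, -, h⟩ := hG r hr
    refine ⟨V, hrV, hV, ?_⟩
    rw [hloc V hV F hF h]
    -- The local expression is a finite sum of products formed inside the ring `moderate M V`.
    exact Subtype.property _
  refine ⟨toAsymp M Ω ⟨g, hg⟩, fun r hr => ?_⟩
  obtain ⟨V, hrV, hV, F, hF, hone, h⟩ := hG r hr
  refine ⟨V, hrV, hV, F, hF, fun l => constAsymp M V (Smooth.restrict hV (ψ l)), ?_, ?_⟩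
  · rw [← map_sum, hone, map_one]
  · have h2 : modRestrict M hV ⟨g, hg⟩ = _ := Subtype.ext (hloc V hV F hF h)
    rw [restrict_mk, h2, map_sum]
    refine Finset.sum_congr rfl fun l _ => ?_
    rw [map_mul, ← restrict_mk, hf]
    rfl

theorem exists_restrict_eq {M : ConvexSubring U} {Λ : Type v} (Ωs : Λ → Opens (Eucl d))
    (Ω : Opens (Eucl d)) (hcov : ⨆ l, Ωs l = Ω) (fs : ∀ l, Asymp M (Ωs l))
    (hfs : ∀ l₁ l₂, ((Ωs l₁ : Set (Eucl d)) ∩ Ωs l₂).Nonempty →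
      restrict (inf_le_left : Ωs l₁ ⊓ Ωs l₂ ≤ Ωs l₁) (fs l₁) =
        restrict (inf_le_right : Ωs l₁ ⊓ Ωs l₂ ≤ Ωs l₂) (fs l₂)) :
    ∃ f : Asymp M Ω, ∀ l, restrict (le_of_cover hcov l) f = fs l := by
  obtain ⟨f, hf⟩ := exists_asymp_gluing M Ωs Ω hcov fs
  refine ⟨f, fun l => sub_eq_zero.1 (eq_zero_of_local fun r hr => ?_)⟩
  obtain ⟨V, hrV, hV, F, hF, ψ, hone, hsum⟩ := hf r (le_of_cover hcov l hr)
  refine ⟨V ⊓ Ωs l, ⟨hrV, hr⟩, inf_le_right, ?_⟩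
  have h1 : restrict (inf_le_left : V ⊓ Ωs l ≤ V) (restrict hV f) =
      restrict (inf_le_right : V ⊓ Ωs l ≤ Ωs l) (fs l) := by
    rw [hsum, map_sum]
    -- Once all local classes are replaced by that of `l`, it factors out of the sum and only `∑ ψ k
    -- = 1` is left.
    have h2 : ∀ k : F, restrict (inf_le_left : V ⊓ Ωs l ≤ V)
        (ψ k * restrict (hF k k.2) (fs k)) =
        restrict (inf_le_left : V ⊓ Ωs l ≤ V) (ψ k) *
          restrict (inf_le_right : V ⊓ Ωs l ≤ Ωs l) (fs l) := by
      intro k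
      -- Compatibility is assumed only on nonempty overlaps; here `r` itself lies in `Ωs k ∩ Ωs l`.
      have h3 := congrArg (restrict (inf_le_inf_right _ (hF k k.2) : V ⊓ Ωs l ≤ Ωs k ⊓ Ωs l))
        (hfs k l ⟨r, hF k k.2 hrV, hr⟩)
      rw [restrict_restrict, restrict_restrict] at h3
      rw [map_mul, restrict_restrict, h3]
    rw [Finset.sum_congr rfl fun k _ => h2 k, ← Finset.sum_mul, ← map_sum, hone, map_one, one_mul]
  rw [map_sub, restrict_restrict, ← h1, restrict_restrict, sub_self]

/-! ### Differential ring structure, checked on representatives. -/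

theorem restrict_asympDeriv {M : ConvexSubring U} {O Ω : Opens (Eucl d)} (h : O ≤ Ω)
    (α : Fin d → ℕ) (f : Asymp M Ω) :
    restrict h (asympDeriv α f) = asympDeriv α (restrict h f) := by
  obtain ⟨f, rfl⟩ := toAsymp_surjective M Ω f
  rw [asympDeriv_mk, restrict_mk, restrict_mk, asympDeriv_mk]
  congr 1
  exact Subtype.ext (starDeriv_starRestrict h α (f : NonStdSmooth U Ω)).symm

theorem asympDeriv_zero {M : ConvexSubring U} {Ω : Opens (Eucl d)} (f : Asymp M Ω) :
    asympDeriv 0 f = f := by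
  obtain ⟨f, rfl⟩ := toAsymp_surjective M Ω f
  rw [asympDeriv_mk]
  exact congrArg _ (Subtype.ext (starDeriv_zero (f : NonStdSmooth U Ω)))

theorem asympDeriv_add_index {M : ConvexSubring U} {Ω : Opens (Eucl d)} (α β : Fin d → ℕ)
    (f : Asymp M Ω) : asympDeriv (α + β) f = asympDeriv α (asympDeriv β f) := by
  obtain ⟨f, rfl⟩ := toAsymp_surjective M Ω f
  rw [asympDeriv_mk, asympDeriv_mk, asympDeriv_mk]
  exact congrArg _ (Subtype.ext (starDeriv_add α β (f : NonStdSmooth U Ω)))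

theorem asympDeriv_add {M : ConvexSubring U} {Ω : Opens (Eucl d)} (α : Fin d → ℕ)
    (f g : Asymp M Ω) : asympDeriv α (f + g) = asympDeriv α f + asympDeriv α g := by
  obtain ⟨f, rfl⟩ := toAsymp_surjective M Ω f
  obtain ⟨g, rfl⟩ := toAsymp_surjective M Ω g
  rw [← map_add, asympDeriv_mk, asympDeriv_mk, asympDeriv_mk, ← map_add, map_add (modDeriv M Ω α)]

theorem asympDeriv_single_mul {M : ConvexSubring U} {Ω : Opens (Eucl d)} (i : Fin d)
    (f g : Asymp M Ω) :
    asympDeriv (Pi.single i 1) (f * g) =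
      asympDeriv (Pi.single i 1) f * g + f * asympDeriv (Pi.single i 1) g := by
  obtain ⟨f, rfl⟩ := toAsymp_surjective M Ω f
  obtain ⟨g, rfl⟩ := toAsymp_surjective M Ω g
  rw [← map_mul, asympDeriv_mk, asympDeriv_mk, asympDeriv_mk, ← map_mul, ← map_mul, ← map_add]
  exact congrArg _ (Subtype.ext
    (starDeriv_single_mul i (f : NonStdSmooth U Ω) (g : NonStdSmooth U Ω)))

/-! ### Supports and the assembled theorem. -/

/-- The union of all open sets on which `f` vanishes is the largest one. -/
theorem isGreatest_vanishingOpens {M : ConvexSubring U} {Ω : Opens (Eucl d)} (f : Asymp M Ω) :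
    IsGreatest (vanishingOpens f) (sSup (vanishingOpens f)) := by
  refine ⟨⟨sSup_le fun O hO => hO.1, ?_⟩, fun O hO => le_sSup hO⟩
  -- Each point of the union has a member of `vanishingOpens f` as a neighbourhood, so locality
  -- gives vanishing on the whole union.
  refine eq_zero_of_local fun r hr => ?_
  obtain ⟨O, hO, hrO⟩ := Opens.mem_sSup.1 hr
  refine ⟨O, hrO, le_sSup hO, ?_⟩
  rw [restrict_restrict]
  exact hO.2

end Sheaf

end AsymptoticFunctions

theorem mainTheorem11 {d : ℕ} {ι : Type*} (U : Ultrafilter ι) (M : ConvexSubring U) :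
    -- each member of the family is a (commutative) differential ring
    (∀ (Ω : Opens (Eucl d)) (f g : Asymp M Ω),
      asympDeriv 0 f = f ∧
      (∀ α β : Fin d → ℕ, asympDeriv (α + β) f = asympDeriv α (asympDeriv β f)) ∧
      (∀ α : Fin d → ℕ, asympDeriv α (f + g) = asympDeriv α f + asympDeriv α g) ∧
      (∀ i : Fin d, asympDeriv (Pi.single i 1) (f * g) =
        asympDeriv (Pi.single i 1) f * g + f * asympDeriv (Pi.single i 1) g)) ∧
    -- (i)
    (∀ (Ω : Opens (Eucl d)) (f : Asymp M Ω), restrict le_rfl f = f) ∧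
    -- (ii)
    (∀ (Ω₁ Ω₂ Ω : Opens (Eucl d)) (h₁ : Ω₁ ≤ Ω₂) (h₂ : Ω₂ ≤ Ω) (f : Asymp M Ω),
      restrict h₁ (restrict h₂ f) = restrict (h₁.trans h₂) f) ∧
    -- (iii) and (iv), for every open covering
    (∀ {Λ : Type*} (Ωs : Λ → Opens (Eucl d)) (Ω : Opens (Eucl d)) (hcov : ⨆ l, Ωs l = Ω),
      (∀ f : Asymp M Ω, (∀ l, restrict (le_of_cover hcov l) f = 0) → f = 0) ∧
      (∀ fs : ∀ l, Asymp M (Ωs l),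
        (∀ l₁ l₂, ((Ωs l₁ : Set (Eucl d)) ∩ Ωs l₂).Nonempty →
          restrict (inf_le_left : Ωs l₁ ⊓ Ωs l₂ ≤ Ωs l₁) (fs l₁) =
            restrict (inf_le_right : Ωs l₁ ⊓ Ωs l₂ ≤ Ωs l₂) (fs l₂)) →
        ∃ f : Asymp M Ω, ∀ l, restrict (le_of_cover hcov l) f = fs l)) ∧
    -- (v)
    (∀ (Ω O : Opens (Eucl d)) (h : O ≤ Ω) (f g : Asymp M Ω),
      (∀ α : Fin d → ℕ, restrict h (asympDeriv α f) = asympDeriv α (restrict h f)) ∧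
      restrict h (f + g) = restrict h f + restrict h g ∧
      restrict h (f * g) = restrict h f * restrict h g) ∧
    -- supports: there is a largest open subset of `Ω` on which `f` vanishes, and its complement
    -- `supp f` in `Ω` is closed in `Ω`
    (∀ (Ω : Opens (Eucl d)) (f : Asymp M Ω),
      (∃ O : Opens (Eucl d), IsGreatest (vanishingOpens f) O ∧
        supp f = (Ω : Set (Eucl d)) \ O) ∧
      IsClosed ((↑) ⁻¹' supp f : Set Ω)) := by
  refine ⟨fun Ω f g => ⟨asympDeriv_zero f, fun α β => asympDeriv_add_index α β f,
      fun α => asympDeriv_add α f g, fun i => asympDeriv_single_mul i f g⟩,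
    fun Ω f => restrict_rfl f, fun Ω₁ Ω₂ Ω h₁ h₂ f => restrict_restrict h₁ h₂ f,
    fun Ωs Ω hcov => ⟨fun f hf => eq_zero_of_local fun r hr => ?_,
      fun fs hfs => exists_restrict_eq Ωs Ω hcov fs hfs⟩,
    fun Ω O h f g => ⟨fun α => restrict_asympDeriv h α f, map_add _ f g, map_mul _ f g⟩,
    fun Ω f => ⟨⟨_, isGreatest_vanishingOpens f, rfl⟩, ?_⟩⟩
  · obtain ⟨l, hl⟩ := Opens.mem_iSup.1 (hcov ▸ hr : r ∈ ⨆ l, Ωs l)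
    exact ⟨Ωs l, hl, le_of_cover hcov l, hf l⟩
  -- Inside `Ω` the support is the complement of the trace of an open set.
  · have : ((↑) ⁻¹' supp f : Set Ω) =
        ((↑) ⁻¹' ((sSup (vanishingOpens f) : Opens (Eucl d)) : Set (Eucl d)) : Set Ω)ᶜ := by
      ext x
      exact ⟨fun h => h.2, fun h => ⟨x.2, h⟩⟩
    rw [this]
    exact ((sSup (vanishingOpens f)).2.preimage continuous_subtype_val).isClosed_compl
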